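/- Fix an odd prime $p$. A graph $C=(V,E)$ (irreflexive, symmetric) is \emph{nice} if $|V|\ge 2$, for any two distinct $v_1,v_2\in V$ there is $u\in V\setminus\{v_1,v_2\}$ adjacent to $v_1$ and not to $v_2$, and $C$ contains no triangles and no squares. Its Mekler group $\mathsf M(C)$ is the group generated freely in the variety of $2$-nilpotent groups of exponent $p$ by the vertices, subject to the relations $[v,w]=1$ for adjacent $v,w$; let $Z$ be its centre. For $g,h$ in a group write $g\sim h$ if $g,h$ have the same centraliser, and $g\approx h$ if $h=g^{\alpha}c$ with $0<\alpha<p$ and $c$ central. A non-central $g$ has type $1^\nu$ if its $\sim$-class is a single $\approx$-class and some non-central element commuting with $g$ is not $\approx$-equivalent to $g$. Let $A_{m,0}$ be the set of $a\in \mathsf M(C)/Z$ which are products modulo $Z$ of $m$ pairwise $\sim$-inequivalent elements $a_0,\dots,a_{m-1}$ of type $1^\nu$, and $S_{m,0}(a)=\{[a_0]_\sim,\dots,[a_{m-1}]_\sim\}$ the support of such an $a$. An inp-pattern of depth $\kappa$ in a complete theory $T$ consists of formulas $\varphi_i(x,y_i)$ ($i<\kappa$; $x$ a single variable, $y_i$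 a finite tuple), tuples $(b_{i,j})_{i<\kappa,\,j<\omega}$ in a model of $T$, and integers $k_i<\omega$ such that each row $\{\varphi_i(x,b_{i,j}):j<\omega\}$ is $k_i$-inconsistent (any $k_i$ of its instances are inconsistent) and for each $\eta\colon\kappa\to\omega$ the path $\{\varphi_i(x,b_{i,\eta(i)}):i<\kappa\}$ is consistent. The burden of a structure is the supremum of the depths of the inp-patterns in its theory, computed in the cardinals extended by an element $\kappa_-$ just below each infinite limit cardinal $\kappa$ (and by a top element); so a burden is at least $\aleph_{0-}$ if and only if there are inp-patterns of every finite depth. \textbf{Proposition.} \begin{enumerate} \item Let $C$ be an infinite nice graph. Then $\mathsf M(C)$, as a structure in the language of groups, has burden at least $\aleph_{0-}$. Moreover, for each $m$ there is a formula $\psi_m(x,y)$ in the language of groups expressing in $\mathsf M(C)$ that $xZ\in A_{m,0}$ and $[y]_\sim\in S_{m,0}(xZ)$, and for every array $(a_{i,j})_{i<m,\,j<\omega}$ of distinct vertices of $C$, the formula $\psi_m$ with the parameters $a_{i,j}$ is an inp-pattern of depth $m$ whose rows are $(m+1)$-inconsistent. \item Consequently, Mekler's construction does not preserve burden, nor its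 finiteness (a negative answer to Problem 5.8 of Chernikov and Hempel): there is an infinite nice graph $C$ of burden $1$, so that the burden of $C$ is strictly less than that of $\mathsf M(C)$. \end{enumerate} -/

import Mathlib

open FirstOrder
open scoped commutatorElement

universe u

namespace Mekler

/-! ### Nice graphs and the Mekler group of a graph -/

/-- A graph is nice if it has at least two vertices, if for any two distinct vertices `v₁, v₂` some
third vertex is adjacent to `v₁` and not to `v₂`, and if it has no triangles and no squares. -/
structure IsNice {V : Type u} (C : SimpleGraph V) : Prop where
  two_le : Nontrivial V
  separated : ∀ v₁ v₂ : V, v₁ ≠ v₂ → ∃ w : V, w ≠ v₁ ∧ w ≠ v₂ ∧ C.Adj v₁ w ∧ ¬ C.Adj v₂ w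
  no_triangle : ∀ a b c : V, ¬ (C.Adj a b ∧ C.Adj b c ∧ C.Adj c a)
  no_square : ∀ a b c d : V, a ≠ c → b ≠ d →
    ¬ (C.Adj a b ∧ C.Adj b c ∧ C.Adj c d ∧ C.Adj d a)

/-- The defining relations of the Mekler group: the laws of the variety of groups of exponent `p`
and of nilpotency class at most two, and the commutation of adjacent vertices. -/
def relations (p : ℕ) {V : Type u} (C : SimpleGraph V) : Set (FreeGroup V) :=
  {r | (∃ x : FreeGroup V, r = x ^ p) ∨
    (∃ x y z : FreeGroup V, r = ⁅⁅x, y⁆, z⁆) ∨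
    (∃ v w : V, C.Adj v w ∧ r = ⁅FreeGroup.of v, FreeGroup.of w⁆)}

/-- The group `M(C)`: it is generated freely, in the variety of `2`-nilpotent groups of
exponent `p`, by the vertices of `C`, subject to the commutation of adjacent vertices. -/
abbrev MeklerGroup (p : ℕ) {V : Type u} (C : SimpleGraph V) : Type u :=
  PresentedGroup (relations p C)

/-- A vertex of `C` as an element of `M(C)`. -/
def vertex (p : ℕ) {V : Type u} (C : SimpleGraph V) (v : V) : MeklerGroup p C :=
  PresentedGroup.of v

/-! ### Elements of type `1^ν`, supports -/

section Types

variable (G : Type u) [Group G]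

/-- `g ∼ h`: the elements `g` and `h` have the same centraliser. -/
def simSetoid : Setoid G where
  r g h := Subgroup.centralizer {g} = Subgroup.centralizer {h}
  iseqv := ⟨fun _ => rfl, fun h => h.symm, fun h₁ h₂ => h₁.trans h₂⟩

variable {G}

/-- `g ≈ h`: the element `h` is, modulo the centre, a power of `g` with exponent prime to `p`. -/
def Approx (p : ℕ) (g h : G) : Prop :=
  ∃ α : ℕ, 0 < α ∧ α < p ∧ ∃ c ∈ Subgroup.center G, h = g ^ α * c

/-- `g` is of type `q`: the `∼`-class of `g` splits into exactly `q` many `≈`-classes. -/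
def IsOfType (p q : ℕ) (g : G) : Prop :=
  ((fun h : G => {k : G | Approx p h k}) '' {h : G | simSetoid G g h}).encard = q

/-- `g` is isolated: every non-central element commuting with `g` is `≈`-equivalent to `g`. -/
def IsIsolated (p : ℕ) (g : G) : Prop :=
  ∀ h : G, h ∉ Subgroup.center G → Commute g h → Approx p g h

/-- The set `E^ν` of (non-central) elements of type `1^ν`, that is of type `1` and not isolated. -/
def typeOneNu (p : ℕ) (G : Type u) [Group G] : Set G :=
  {g | g ∉ Subgroup.center G ∧ IsOfType p 1 g ∧ ¬ IsIsolated p g}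

/-- `a = x₀ ⋯ x_{n-1}` in `G / Z(G)`, for `n` pairwise `∼`-inequivalent elements `xᵢ`
of type `1^ν`. -/
def IsDecomposition (p n : ℕ) (a : G ⧸ Subgroup.center G) (x : Fin n → G) : Prop :=
  (∀ i, x i ∈ typeOneNu p G) ∧ (∀ i j, simSetoid G (x i) (x j) → i = j) ∧
    a = QuotientGroup.mk (List.ofFn x).prod

/-- The predicate `A_{n,0}` on `G / Z(G)`: the elements with support of size `n`. -/
def supportPredicate (p n : ℕ) (G : Type u) [Group G] : Set (G ⧸ Subgroup.center G) :=
  {a | ∃ x : Fin n → G, IsDecomposition p n a x}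

/-- The support `S_{n,0}(a)` of an element `a` of `A_{n,0}`: the set of `∼`-classes of the
factors in a decomposition of `a` as a product of `n` inequivalent elements of type `1^ν`. -/
def support (p n : ℕ) (a : G ⧸ Subgroup.center G) : Set (Quotient (simSetoid G)) :=
  {γ | ∃ x : Fin n → G, IsDecomposition p n a x ∧ ∃ i, γ = Quotient.mk (simSetoid G) (x i)}

end Types

/-! ### The language of groups -/

/-- The function symbols of the language of groups. -/
inductive GroupFunc : ℕ → Type
  | mul : GroupFunc 2
  | inv : GroupFunc 1
  | one : GroupFunc 0

/-- The language of groups `{·, ⁻¹, 1}`. -/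
def groupLang : FirstOrder.Language.{0, 0} :=
  ⟨GroupFunc, fun _ => Empty⟩

/-- A group as a first-order structure. -/
instance groupStructure (G : Type u) [Group G] : groupLang.Structure G where
  funMap {_} f := match f with
    | GroupFunc.mul => fun x => x 0 * x 1
    | GroupFunc.inv => fun x => (x 0)⁻¹
    | GroupFunc.one => fun _ => 1
  RelMap {_} r := nomatch r

/-! ### Inp-patterns and burden -/

/-- The formulas `φᵢ(x, yᵢ)` (with `x` a single variable and `yᵢ` an `nᵢ`-tuple), together with the
parameters `b i j` and the natural numbers `kᵢ`, form an inp-pattern with set of rows `ι`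
in the theory of `N`: each row `{φᵢ(x, b i j) : j < ω}` is `kᵢ`-inconsistent, and each path
`{φᵢ(x, b i (η i)) : i ∈ ι}` is consistent with the elementary diagram of `N`. -/
structure IsInpPattern (L : FirstOrder.Language.{0, 0}) (N : Type u) [L.Structure N] {ι : Type*}
    (n : ι → ℕ) (φ : ∀ i, L.Formula (Unit ⊕ Fin (n i))) (b : ∀ i, ℕ → Fin (n i) → N)
    (k : ι → ℕ) : Prop where
  row_inconsistent : ∀ i, ∀ s : Finset ℕ, s.card = k i →
    ¬ ∃ a : N, ∀ j ∈ s, (φ i).Realize (Sum.elim (fun _ => a) (b i j))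
  path_consistent : ∀ η : ι → ℕ, ∀ t : Finset ι,
    ∃ a : N, ∀ i ∈ t, (φ i).Realize (Sum.elim (fun _ => a) (b i (η i)))

/-- The complete theory of `M` has an inp-pattern of depth `κ` (in one variable `x`), with
parameters in some model of this theory. -/
def HasInpPattern (L : FirstOrder.Language.{0, 0}) (M : Type u) [L.Structure M] (κ : Cardinal.{u}) : Prop :=
  ∃ (N : Type u) (_ : L.Structure N), L.ElementarilyEquivalent M N ∧
    ∃ (ι : Type u) (n : ι → ℕ) (φ : ∀ i, L.Formula (Unit ⊕ Fin (n i)))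
      (b : ∀ i, ℕ → Fin (n i) → N) (k : ι → ℕ),
      Cardinal.mk ι = κ ∧ IsInpPattern L N n φ b k

/-- Burdens are taken in the linear order `Card*`, where just below each infinite limit cardinal `κ`
a new element `κ₋` is added (and an element `∞` on top), so that each set of cardinals without a
maximum has a supremum of this form. It is realised as the order of lower sets of
cardinals: the cardinal `κ` is the lower set `{μ | μ ≤ κ}`, the element `κ₋` is `{μ | μ < κ}`, and
`∞` is the set of all cardinals. -/
abbrev ExtCardinal : Type (u + 1) := LowerSet Cardinal.{u}

/-- A cardinal as an element of `Card*`. -/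
def ExtCardinal.ofCardinal (κ : Cardinal.{u}) : ExtCardinal.{u} := LowerSet.Iic κ

/-- The element `ℵ₀₋` of `Card*`, the supremum of the finite cardinals. -/
def ExtCardinal.alephZeroMinus : ExtCardinal.{u} := LowerSet.Iio Cardinal.aleph0

/-- The burden of (the complete theory of) `M`: the supremum in `Card*` of the depths
of its inp-patterns. -/
def burden (L : FirstOrder.Language.{0, 0}) (M : Type u) [L.Structure M] : ExtCardinal.{u} :=
  ⨆ κ ∈ {κ : Cardinal.{u} | HasInpPattern L M κ}, ExtCardinal.ofCardinal κ

/-- The burden of a graph, as a structure in the language of graphs. -/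
def graphBurden {V : Type u} (C : SimpleGraph V) : ExtCardinal.{u} :=
  @burden FirstOrder.Language.graph V C.structure

/-- The burden of a group, as a structure in the language of groups. -/
def groupBurden (G : Type u) [Group G] : ExtCardinal.{u} :=
  burden groupLang G

end Mekler

/-!
Every element of the Mekler group `M(C)` has a vector of exponents in the `ZMod p`-vector space on
the vertices (`exponents`), and two elements commute if and only if the `2 × 2` minors of their
exponents vanish at all non-edges of `C` (`commute_iff_orthogonal`). One direction maps `M(C)` to
a Heisenberg group over `ZMod p`, the other uses that the commutator is bilinear and alternating;
both need `p` to be odd. Hence, for a nice graph, the centre is the kernel of `exponents`, and the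
relations `∼` and `≈` become statements of linear algebra about vectors with finite support.

The elements of type `1^ν` are exactly those whose exponents are supported at a single vertex
(`mem_typeOneNu_iff`). If the support of `g` has at least two elements and `g` is not isolated,
then, there being no triangles and no squares, some vertex `w` is adjacent to all other elements of
the support (`IsNice.exists_hub`), and changing the exponent at `w` changes the `≈`-class of `g` but
not its centraliser (`IsNice.exists_orthogonal_iff`). So the support of an element of `A_{m,0}` is
determined by its exponents and contains at most `m` vertices. This makes the rows of the pattern
`(m + 1)`-inconsistent, while a path is realised by the product of its vertices
(`isInpPattern_support`). The formula is obtained from closure properties of the expressible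
relations (`exists_formula_support`).

The graph of burden `1` is the two-way infinite path on `ℤ`. A back-and-forth argument with
truncated differences (`exists_locallyEquiv_realize_iff`) shows that a formula defines finite or
cofinite sets in it, uniformly in the parameters. By the uniformity this transfers to all
models of the theory of the path (`finite_or_finite_compl_of_elementarilyEquivalent`). A pattern
with two rows would contain a finite set meeting infinitely many members of the other row, against
the inconsistency of that row (`IsInpPattern.subsingleton`).
-/

namespace Mekler

/-! ### The path on the integers -/

/-- The two-way infinite path: the graph on `ℤ` in which consecutive integers are adjacent. -/
def integerPath : SimpleGraph ℤ where
  Adj a b := b = a + 1 ∨ a = b + 1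
  symm := ⟨fun _ _ h => h.symm⟩
  loopless := ⟨fun a h => by omega⟩

lemma integerPath_adj {a b : ℤ} : integerPath.Adj a b ↔ b = a + 1 ∨ a = b + 1 := Iff.rfl

lemma isNice_integerPath : IsNice integerPath where
  two_le := inferInstance
  separated a b hab := by
    simp only [integerPath_adj]
    by_cases h : b = a - 1 ∨ b = a - 2
    · exact ⟨a + 1, by omega, by omega, by omega, by omega⟩
    · exact ⟨a - 1, by omega, by omega, by omega, by omega⟩
  no_triangle a b c := by simp only [integerPath_adj]; omega
  no_square a b c d := by simp only [integerPath_adj]; omega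

/-! ### Definable sets in models of the theory of the path -/

/-- Two families of integers are equivalent at scale `D` if they have the same differences between
members at distance at most `D` in either family. -/
def LocallyEquiv {β : Type*} (D : ℤ) (v v' : β → ℤ) : Prop :=
  ∀ i j, |v i - v j| ≤ D ∨ |v' i - v' j| ≤ D → v i - v j = v' i - v' j

lemma LocallyEquiv.mono {β : Type*} {D E : ℤ} (h : D ≤ E) {v v' : β → ℤ}
    (hv : LocallyEquiv E v v') : LocallyEquiv D v v' :=
  fun i j hij => hv i j (hij.imp (le_trans · h) (le_trans · h))

lemma LocallyEquiv.symm {β : Type*} {D : ℤ} {v v' : β → ℤ}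
    (hv : LocallyEquiv D v v') : LocallyEquiv D v' v :=
  fun i j hij => (hv i j hij.symm).symm

lemma exists_int_far {β : Type*} [Finite β] (v : β → ℤ) (D : ℤ) : ∃ a, ∀ i, D < |v i - a| := by
  obtain ⟨B, hB⟩ := (Set.finite_range v).bddAbove
  refine ⟨B + |D| + 1, fun i => ?_⟩
  have h := hB ⟨i, rfl⟩
  have := le_abs_self D
  rw [abs_of_neg (by have := abs_nonneg D; omega)]
  omega

/-- The back-and-forth step: halving the scale makes room for one more element. -/
lemma LocallyEquiv.exists_extend {β : Type*} [Finite β] {D : ℤ} {v v' : β → ℤ}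
    (hv : LocallyEquiv (2 * D) v v') (a : ℤ) :
    ∃ a', ∀ i, |v i - a| ≤ D ∨ |v' i - a'| ≤ D → v i - a = v' i - a' := by
  by_cases h : ∃ j, |v j - a| ≤ D
  · obtain ⟨j, hj⟩ := h
    refine ⟨v' j + (a - v j), fun i hi => ?_⟩
    have := hv i j (by simp only [abs_le] at *; omega)
    omega
  · push Not at h
    obtain ⟨a', ha'⟩ := exists_int_far v' D
    exact ⟨a', fun i hi => absurd hi (by have := h i; have := ha' i; omega)⟩

lemma LocallyEquiv.snoc {α : Type*} {n : ℕ} {D : ℤ} {v v' : α → ℤ} {x x' : Fin n → ℤ}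
    (h : LocallyEquiv D (Sum.elim v x) (Sum.elim v' x')) {a a' : ℤ}
    (ha : ∀ i, |Sum.elim v x i - a| ≤ D ∨ |Sum.elim v' x' i - a'| ≤ D →
      Sum.elim v x i - a = Sum.elim v' x' i - a') :
    LocallyEquiv D (Sum.elim v (Fin.snoc x a : Fin (n + 1) → ℤ))
      (Sum.elim v' (Fin.snoc x' a' : Fin (n + 1) → ℤ)) := by
  have ha' : ∀ i, |a - Sum.elim v x i| ≤ D ∨ |a' - Sum.elim v' x' i| ≤ D →
      a - Sum.elim v x i = a' - Sum.elim v' x' i := fun i hi => by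
    have := ha i (by rwa [abs_sub_comm, abs_sub_comm _ a'])
    omega
  have key : ∀ i : α ⊕ Fin (n + 1), (∃ k, Sum.elim v (Fin.snoc x a : Fin (n + 1) → ℤ) i =
        Sum.elim v x k ∧ Sum.elim v' (Fin.snoc x' a' : Fin (n + 1) → ℤ) i = Sum.elim v' x' k) ∨
      (Sum.elim v (Fin.snoc x a : Fin (n + 1) → ℤ) i = a ∧
        Sum.elim v' (Fin.snoc x' a' : Fin (n + 1) → ℤ) i = a') := by
    rintro (i | i)
    · exact Or.inl ⟨Sum.inl i, rfl, rfl⟩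
    · induction i using Fin.lastCases with
      | last => exact Or.inr (by simp)
      | cast i => exact Or.inl ⟨Sum.inr i, by simp⟩
  intro i j hij
  rcases key i with ⟨k, hk, hk'⟩ | ⟨hk, hk'⟩ <;> rcases key j with ⟨l, hl, hl'⟩ | ⟨hl, hl'⟩ <;>
    rw [hk, hk', hl, hl'] at hij ⊢
  · exact h k l hij
  · exact ha k hij
  · exact ha' l hij
  · simp

/-- A formula in the language of graphs, interpreted in the path, cannot distinguish tuples
which are equivalent at a scale depending on the formula. -/
lemma exists_locallyEquiv_realize_iff {α : Type*} [Finite α] {n : ℕ}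
    (φ : Language.graph.BoundedFormula α n) :
    letI := integerPath.structure
    ∃ D : ℤ, 0 ≤ D ∧ ∀ (v v' : α → ℤ) (x x' : Fin n → ℤ),
      LocallyEquiv D (Sum.elim v x) (Sum.elim v' x') → (φ.Realize v x ↔ φ.Realize v' x') := by
  let := integerPath.structure
  -- The language of graphs has no function symbols.
  have isVar : ∀ {m : ℕ} (t : Language.graph.Term (α ⊕ Fin m)), ∃ i, t = Language.var i := by
    rintro m (i | ⟨f, -⟩)
    · exact ⟨i, rfl⟩
    · exact f.elim
  induction φ with
  | falsum => exact ⟨0, le_rfl, fun _ _ _ _ _ => Iff.rfl⟩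
  | equal t₁ t₂ =>
    obtain ⟨i, rfl⟩ := isVar t₁
    obtain ⟨j, rfl⟩ := isVar t₂
    refine ⟨0, le_rfl, fun v v' x x' h => ?_⟩
    have := h i j
    simp only [Language.BoundedFormula.Realize, Language.Term.realize_var]
    constructor
    · intro e
      have := this (by simp [e])
      omega
    · intro e
      have := this (by simp [e])
      omega
  | rel R ts =>
    cases R
    obtain ⟨i, hi⟩ := isVar (ts 0)
    obtain ⟨j, hj⟩ := isVar (ts 1)
    refine ⟨1, by simp, fun v v' x x' h => ?_⟩
    have h := h i j
    change integerPath.Adj ((ts 0).realize _) ((ts 1).realize _) ↔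
      integerPath.Adj ((ts 0).realize _) ((ts 1).realize _)
    rw [hi, hj]
    simp only [Language.Term.realize_var, integerPath_adj]
    simp only [abs_le] at h
    omega
  | imp φ ψ hφ hψ =>
    obtain ⟨D, hD, h₁⟩ := hφ
    obtain ⟨E, hE, h₂⟩ := hψ
    refine ⟨max D E, le_max_of_le_left hD, fun v v' x x' h => ?_⟩
    simp only [Language.BoundedFormula.realize_imp]
    rw [h₁ v v' x x' (h.mono (le_max_left _ _)), h₂ v v' x x' (h.mono (le_max_right _ _))]
  | all φ hφ =>
    obtain ⟨D, hD, h₁⟩ := hφ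
    have one_side : ∀ (v v' : α → ℤ) (x x' : Fin _ → ℤ),
        LocallyEquiv (2 * D) (Sum.elim v x) (Sum.elim v' x') →
        φ.all.Realize v x → φ.all.Realize v' x' := by
      intro v v' x x' h hx a'
      obtain ⟨a, ha⟩ := h.symm.exists_extend a'
      have h' := (h.symm.mono (by omega)).snoc ha
      exact (h₁ _ _ _ _ h').2 (hx a)
    exact ⟨2 * D, by omega, fun v v' x x' h =>
      ⟨one_side v v' x x' h, one_side v' v x' x h.symm⟩⟩

/-- In the path, a formula with parameters defines a set which is finite or cofinite, with a bound
which does not depend on the parameters. -/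
lemma integerPath_uniformly_minimal {n : ℕ} (φ : Language.graph.Formula (Unit ⊕ Fin n)) :
    letI := integerPath.structure
    ∃ K : ℕ, ∀ b : Fin n → ℤ, ∀ s t : Finset ℤ,
      (∀ a ∈ s, φ.Realize (Sum.elim (fun _ => a) b)) →
      (∀ a ∈ t, ¬ φ.Realize (Sum.elim (fun _ => a) b)) → s.card < K ∨ t.card < K := by
  let := integerPath.structure
  obtain ⟨D, hD, h⟩ := exists_locallyEquiv_realize_iff φ
  refine ⟨n * (2 * D + 1).toNat + 1, fun b s t hs ht => ?_⟩
  by_contra! hcard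
  -- The elements at distance at most `D` from the parameters.
  let B : Finset ℤ := Finset.univ.biUnion fun i => Finset.Icc (b i - D) (b i + D)
  have hB : B.card ≤ n * (2 * D + 1).toNat := by
    refine (Finset.card_biUnion_le_card_mul _ _ (2 * D + 1).toNat fun i _ => ?_).trans_eq
      (by simp)
    rw [Int.card_Icc]
    exact Int.toNat_le_toNat (by omega)
  obtain ⟨x, hx, hxB⟩ := Finset.exists_mem_notMem_of_card_lt_card (s := B) (t := s) (by omega)
  obtain ⟨y, hy, hyB⟩ := Finset.exists_mem_notMem_of_card_lt_card (s := B) (t := t) (by omega)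
  simp only [B, Finset.mem_biUnion, Finset.mem_univ, true_and, Finset.mem_Icc, not_exists]
    at hxB hyB
  refine ht y hy ((h _ _ _ _ ?_).1 (hs x hx))
  rintro ((i | i) | i) ((j | j) | j) hij
  · simp
  · have := hxB j
    have := hyB j
    simp only [Sum.elim_inl, Sum.elim_inr, abs_le] at hij ⊢
    omega
  · exact j.elim0
  · have := hxB i
    have := hyB i
    simp only [Sum.elim_inl, Sum.elim_inr, abs_le] at hij ⊢
    omega
  · simp
  · exact j.elim0
  all_goals exact i.elim0

/-- In every structure elementarily equivalent to the path, the subsets of the line definable with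
parameters are finite or cofinite. -/
lemma finite_or_finite_compl_of_elementarilyEquivalent {N : Type} [Language.graph.Structure N]
    (hN : letI := integerPath.structure; Language.graph.ElementarilyEquivalent ℤ N) {n : ℕ}
    (φ : Language.graph.Formula (Unit ⊕ Fin n)) (b : Fin n → N) :
    {a : N | φ.Realize (Sum.elim (fun _ => a) b)}.Finite ∨
      {a : N | φ.Realize (Sum.elim (fun _ => a) b)}ᶜ.Finite := by
  classical
  let := integerPath.structure
  obtain ⟨K, hK⟩ := integerPath_uniformly_minimal φ
  -- `θ` states that `xᵢ` (for `i < K`) are distinct realisations of `φ(·, y)`, and `x'ᵢ` are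
  -- distinct realisations of its negation.
  let inst (f : Fin K → (Fin K ⊕ Fin K) ⊕ Fin n) (ψ : Language.graph.Formula (Unit ⊕ Fin n)) :
      Language.graph.Formula ((Fin K ⊕ Fin K) ⊕ Fin n) :=
    (Language.Formula.iInf fun i => ψ.relabel (Sum.elim (fun _ => f i) Sum.inr)) ⊓
      Language.Formula.iInf fun q : {q : Fin K × Fin K // q.1 ≠ q.2} =>
        ∼((Language.var (f q.1.1)).equal (Language.var (f q.1.2)))
  have inst_realize : ∀ {M : Type} [Language.graph.Structure M] f ψ (v : _ → M),
      (inst f ψ).Realize v ↔ (∀ i, ψ.Realize (Sum.elim (fun _ => v (f i)) (v ∘ Sum.inr))) ∧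
        Function.Injective (v ∘ f) := by
    intro M _ f ψ v
    simp only [inst, Language.Formula.realize_inf, Language.Formula.realize_iInf,
      Language.Formula.realize_relabel, Language.Formula.realize_not, Subtype.forall,
      Language.Formula.realize_equal, Language.Term.realize_var, Prod.forall]
    refine and_congr (forall_congr' fun i => ?_) ?_
    · rw [Sum.comp_elim]; rfl
    · exact ⟨fun h i j hij => by_contra fun hne => h i j hne hij, fun h i j hne hij => hne (h hij)⟩
  let θ := inst (fun i => Sum.inl (Sum.inl i)) φ ⊓ inst (fun i => Sum.inl (Sum.inr i)) ∼φ
  have θ_realize : ∀ {M : Type} [Language.graph.Structure M],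
      M ⊨ (Language.Formula.iExs _ (θ.relabel Sum.inr) : Language.graph.Formula Empty) ↔
        ∃ v : _ → M, θ.Realize v := by
    intro M _
    rw [Language.Sentence.Realize, Language.Formula.realize_iExs]
    simp only [Language.Formula.realize_relabel, Sum.elim_comp_inr]
  by_contra! hinf
  obtain ⟨h₁, h₂⟩ := hinf
  let e₁ := h₁.natEmbedding
  let e₂ := h₂.natEmbedding
  have hθN : ∃ v : _ → N, θ.Realize v := by
    refine ⟨Sum.elim (Sum.elim (fun i => (e₁ i : N)) (fun i => (e₂ i : N))) b, ?_⟩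
    rw [Language.Formula.realize_inf]
    refine ⟨(inst_realize _ _ _).2 ⟨fun i => (e₁ i).2, fun i j h => ?_⟩,
      (inst_realize _ _ _).2 ⟨fun i => (e₂ i).2, fun i j h => ?_⟩⟩
    · exact Fin.ext (e₁.injective (Subtype.ext h))
    · exact Fin.ext (e₂.injective (Subtype.ext h))
  obtain ⟨v, hv⟩ := θ_realize.1 ((hN.realize_sentence _).2 (θ_realize.2 hθN))
  rw [Language.Formula.realize_inf] at hv
  obtain ⟨hs, hsi⟩ := (inst_realize _ _ _).1 hv.1
  obtain ⟨ht, hti⟩ := (inst_realize _ _ _).1 hv.2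
  have := hK (v ∘ Sum.inr) (Finset.univ.image (v ∘ fun i => Sum.inl (Sum.inl i)))
    (Finset.univ.image (v ∘ fun i => Sum.inl (Sum.inr i))) (by simpa using hs) (by simpa using ht)
  rw [Finset.card_image_of_injective _ hsi, Finset.card_image_of_injective _ hti] at this
  simp at this

/-! ### The burden of the path -/

/-- If all sets defined by the formulas of an inp-pattern are finite or cofinite, then
the pattern has at most one row. -/
lemma IsInpPattern.subsingleton {L : FirstOrder.Language.{0, 0}} {N : Type u} [L.Structure N]
    {ι : Type*} {n : ι → ℕ} {φ : ∀ i, L.Formula (Unit ⊕ Fin (n i))} {b : ∀ i, ℕ → Fin (n i) → N}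
    {k : ι → ℕ}
    (h : IsInpPattern L N n φ b k)
    (hmin : ∀ i j, {a : N | (φ i).Realize (Sum.elim (fun _ => a) (b i j))}.Finite ∨
      {a : N | (φ i).Realize (Sum.elim (fun _ => a) (b i j))}ᶜ.Finite) : Subsingleton ι := by
  classical
  refine ⟨fun i i' => by_contra fun hne => ?_⟩
  -- A row of infinite, hence cofinite, sets is not `k`-inconsistent.
  obtain ⟨j₀, hj₀⟩ : ∃ j, {a : N | (φ i).Realize (Sum.elim (fun _ => a) (b i j))}.Finite := by
    by_contra! hinf
    have hcof := fun j => (hmin i j).resolve_left (hinf j)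
    have hfin : (⋃ j ∈ Finset.range (k i),
        {a : N | (φ i).Realize (Sum.elim (fun _ => a) (b i j))}ᶜ).Finite :=
      (Finset.range (k i)).finite_toSet.biUnion fun j _ => hcof j
    have : Infinite N := Set.infinite_univ_iff.1 ((hinf 0).mono (Set.subset_univ _))
    obtain ⟨a, ha⟩ := hfin.exists_notMem
    simp only [Set.mem_iUnion, Set.mem_compl_iff, Set.mem_ofPred_eq, not_exists, not_not] at ha
    exact h.row_inconsistent i (Finset.range (k i)) (Finset.card_range _) ⟨a, ha⟩
  have hpath : ∀ j, ∃ a ∈ {a : N | (φ i).Realize (Sum.elim (fun _ => a) (b i j₀))},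
      (φ i').Realize (Sum.elim (fun _ => a) (b i' j)) := by
    intro j
    obtain ⟨a, ha⟩ := h.path_consistent (fun l => if l = i then j₀ else j) {i, i'}
    have h₁ := ha i (by simp)
    have h₂ := ha i' (by simp)
    rw [if_pos rfl] at h₁
    rw [if_neg (Ne.symm hne)] at h₂
    exact ⟨a, h₁, h₂⟩
  choose a ha ha' using hpath
  -- The finite set of the first row meets all sets of the second row, so one of its elements lies
  -- in infinitely many of them.
  have := hj₀.to_subtype
  obtain ⟨c, hc⟩ := Finite.exists_infinite_fiber fun j => (⟨a j, ha j⟩ :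
    {a : N | (φ i).Realize (Sum.elim (fun _ => a) (b i j₀))})
  obtain ⟨s, hs, hcard⟩ := (Set.infinite_coe_iff.1 hc).exists_subset_card_eq (k i')
  refine h.row_inconsistent i' s hcard ⟨c, fun j hj => ?_⟩
  have : a j = c := congrArg Subtype.val (hs hj : _ = c)
  exact this ▸ ha' j

lemma mem_burden_iff {L : FirstOrder.Language.{0, 0}} {M : Type u} [L.Structure M]
    {μ : Cardinal.{u}} :
    μ ∈ burden L M ↔ ∃ κ, HasInpPattern L M κ ∧ μ ≤ κ := by
  simp [burden, ExtCardinal.ofCardinal]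

lemma graphBurden_integerPath : graphBurden integerPath = ExtCardinal.ofCardinal 1 := by
  let := integerPath.structure
  ext μ
  change μ ∈ burden Language.graph ℤ ↔ μ ≤ 1
  rw [mem_burden_iff]
  constructor
  · rintro ⟨κ, ⟨N, _, hN, ι, n, φ, b, k, rfl, h⟩, hμ⟩
    refine hμ.trans (Cardinal.le_one_iff_subsingleton.2 (h.subsingleton fun i j => ?_))
    exact finite_or_finite_compl_of_elementarilyEquivalent hN _ _
  · intro hμ
    refine ⟨1, ⟨ℤ, inferInstance, rfl, Unit, fun _ => 1, fun _ =>
      (Language.var (Sum.inl ())).equal (Language.var (Sum.inr 0)), fun _ j _ => j, fun _ => 2,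
      Cardinal.mk_fintype _ |>.trans (by simp), ⟨?_, ?_⟩⟩, hμ⟩
    · rintro _ s hs ⟨a, ha⟩
      obtain ⟨i, hi, j, hj, hij⟩ := Finset.one_lt_card.1 (by omega : 1 < s.card)
      have h₁ := ha i hi
      have h₂ := ha j hj
      simp only [Language.Formula.realize_equal, Language.Term.realize_var, Sum.elim_inl,
        Sum.elim_inr] at h₁ h₂
      omega
    · intro η t
      exact ⟨η (), fun i _ => by simp⟩

/-! ### The form of a nice graph on finitely supported vectors -/

section Form

variable {V : Type*} {C : SimpleGraph V} {F : Type*} [Field F]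

/-- The vectors `g` and `h` have vanishing `2 × 2` minors at all non-edges of the graph. For
`F = ZMod p`, this is the commutation relation of the Mekler group, read modulo its centre. -/
def Orthogonal (C : SimpleGraph V) (g h : V →₀ F) : Prop :=
  ∀ u w, ¬ C.Adj u w → g u * h w = g w * h u

lemma IsNice.exists_adj (hC : IsNice C) (v : V) : ∃ w, C.Adj v w := by
  have := hC.two_le
  obtain ⟨u, hu⟩ := exists_ne v
  obtain ⟨w, -, -, hw, -⟩ := hC.separated v u hu.symm
  exact ⟨w, hw⟩

lemma IsNice.exists_not_adj (hC : IsNice C) (v : V) : ∃ w, w ≠ v ∧ ¬ C.Adj v w := by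
  have := hC.two_le
  obtain ⟨u, hu⟩ := exists_ne v
  obtain ⟨w, -, hw, -, hw'⟩ := hC.separated u v hu
  exact ⟨w, hw, hw'⟩

lemma Orthogonal.smul {g h : V →₀ F} (H : Orthogonal C g h) (c : F) : Orthogonal C (c • g) h := by
  intro u w huw
  simp only [Finsupp.smul_apply, smul_eq_mul, mul_assoc, H u w huw]

lemma orthogonal_single_single {u w : V} (h : C.Adj u w) (a b : F) :
    Orthogonal C (Finsupp.single u a) (Finsupp.single w b) := by
  classical
  intro x y hxy
  have hyx : ¬ C.Adj y x := fun h' => hxy h'.symm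
  simp only [Finsupp.single_apply]
  split_ifs <;> subst_vars <;> simp_all

lemma Orthogonal.eq_zero_of_single {v u : V} {a : F} {h : V →₀ F}
    (H : Orthogonal C (Finsupp.single v a) h) (ha : a ≠ 0) (huv : u ≠ v) (hadj : ¬ C.Adj v u) :
    h u = 0 := by
  classical
  have := H v u hadj
  simpa [Finsupp.single_apply, huv.symm, ha] using this

lemma IsNice.forall_orthogonal_iff (hC : IsNice C) (g : V →₀ F) :
    (∀ h, Orthogonal C g h) ↔ g = 0 := by
  classical
  refine ⟨fun H => ?_, fun h => by subst h; exact fun h u w _ => by simp⟩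
  ext u
  obtain ⟨w, hwu, hw⟩ := hC.exists_not_adj u
  simpa [Finsupp.single_apply, hwu] using H (Finsupp.single w 1) u w hw

/-- A vector with the same orthogonal as a vertex is a multiple of this vertex. -/
lemma IsNice.eq_single_of_orthogonal_iff (hC : IsNice C) {v : V} {a : F} (ha : a ≠ 0) {h : V →₀ F}
    (H : ∀ k, Orthogonal C (Finsupp.single v a) k ↔ Orthogonal C h k) :
    h = Finsupp.single v (h v) := by
  classical
  ext u
  by_cases huv : u = v
  · subst huv; simp
  rw [Finsupp.single_apply, if_neg (Ne.symm huv)]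
  have hvh : Orthogonal C (Finsupp.single v a) h := (H h).2 fun _ _ _ => mul_comm _ _
  by_cases hadj : C.Adj v u
  · obtain ⟨w, -, hwu, hvw, huw⟩ := hC.separated v u (Ne.symm huv)
    have := (H _).1 (orthogonal_single_single hvw a 1) u w huw
    simpa [Finsupp.single_apply, hwu] using this
  · exact hvh.eq_zero_of_single ha huv hadj

/-- If a vector `g` is orthogonal to a vector which is not proportional to it, then some vertex is
adjacent to all other vertices in the support of `g`. -/
lemma IsNice.exists_hub (hC : IsNice C) {g h : V →₀ F} (H : Orthogonal C g h) (h0 : h ≠ 0)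
    (hne : ∀ α : F, α ≠ 0 → h ≠ α • g) : ∃ w, ∀ u, g u ≠ 0 → u ≠ w → C.Adj w u := by
  -- The support of `g` decomposes according to the value of the ratio `h / g`, and elements with
  -- different ratios are adjacent.
  have hadj : ∀ u v, g u ≠ 0 → g v ≠ 0 → h u / g u ≠ h v / g v → C.Adj u v := by
    intro u v hu hv huv
    by_contra hn
    refine huv ?_
    rw [div_eq_div_iff hu hv, mul_comm (h u), mul_comm (h v)]
    exact (H u v hn).symm
  by_cases hratio : ∃ u₁ u₂, g u₁ ≠ 0 ∧ g u₂ ≠ 0 ∧ h u₁ / g u₁ ≠ h u₂ / g u₂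
  · obtain ⟨u₁, u₂, hu₁, hu₂, h₁₂⟩ := hratio
    -- Only two ratios occur, since there are no triangles.
    have htwo : ∀ u, g u ≠ 0 → h u / g u ≠ h u₁ / g u₁ → h u / g u = h u₂ / g u₂ := by
      intro u hu h₁
      by_contra h₂
      exact hC.no_triangle u u₁ u₂ ⟨hadj _ _ hu hu₁ h₁, hadj _ _ hu₁ hu₂ h₁₂,
        hadj _ _ hu₂ hu (Ne.symm h₂)⟩
    -- One of the two ratios occurs only once, since there are no squares.
    by_cases hsing : ∀ u, g u ≠ 0 → h u / g u = h u₁ / g u₁ → u = u₁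
    · exact ⟨u₁, fun u hu hne => hadj _ _ hu₁ hu fun e => hne (hsing u hu e.symm)⟩
    · push Not at hsing
      obtain ⟨u₁', hu₁', he, hne'⟩ := hsing
      refine ⟨u₂, fun u hu hne₂ => hadj _ _ hu₂ hu fun e => ?_⟩
      exact hC.no_square u₁ u u₁' u₂ (Ne.symm hne') hne₂
        ⟨hadj _ _ hu₁ hu (e ▸ h₁₂), hadj _ _ hu hu₁' (by rw [← e, he]; exact h₁₂.symm),
          hadj _ _ hu₁' hu₂ (he ▸ h₁₂), hadj _ _ hu₂ hu₁ h₁₂.symm⟩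
  · push Not at hratio
    -- All ratios are equal to some `c`, and `h - c • g` is supported outside the support of `g`.
    obtain ⟨c, hc⟩ : ∃ c, ∀ u, g u ≠ 0 → h u = c * g u := by
      by_cases hg : ∃ v, g v ≠ 0
      · obtain ⟨v, hv⟩ := hg
        refine ⟨h v / g v, fun u hu => ?_⟩
        rw [hratio v u hv hu, div_mul_cancel₀ _ hu]
      · push Not at hg
        exact ⟨0, fun u hu => absurd (hg u) hu⟩
    obtain ⟨w, hw⟩ : ∃ w, h w ≠ c * g w := by
      by_contra! hall
      have hcg : h = c • g := by ext u; simpa using hall u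
      by_cases hc0 : c = 0
      · exact h0 (by simpa [hc0] using hcg)
      · exact hne c hc0 hcg
    have hgw : g w = 0 := by_contra fun hgw => hw (hc w hgw)
    refine ⟨w, fun u hu _ => by_contra fun hn => hw ?_⟩
    have := H w u hn
    rw [hgw, zero_mul, eq_comm, mul_eq_zero] at this
    rw [hgw, mul_zero]
    exact this.resolve_left hu

/-- If a vertex `w` is adjacent to all other vertices in the support of `g`, and this support has
two elements, then the coefficient of `g` at `w` can be changed without changing the vectors
orthogonal to `g`. -/
lemma IsNice.exists_orthogonal_iff (hC : IsNice C) (h2 : (2 : F) ≠ 0) {g : V →₀ F} {w : V}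
    (hw : ∀ u, g u ≠ 0 → u ≠ w → C.Adj w u) {v v' : V} (hv : g v ≠ 0) (hv' : g v' ≠ 0)
    (hvv' : v ≠ v') :
    ∃ g' : V →₀ F, (∀ k, Orthogonal C g k ↔ Orthogonal C g' k) ∧ ∀ α : F, g' ≠ α • g := by
  classical
  obtain ⟨c, hc0, hc⟩ : ∃ c : F, c ≠ 0 ∧ g w + c ≠ 0 := by
    by_cases h : g w = 0
    · exact ⟨1, one_ne_zero, by simp [h]⟩
    · exact ⟨g w, h, by rw [← two_mul]; exact mul_ne_zero h2 h⟩
  have happ : ∀ u, u ≠ w → (g + Finsupp.single w c) u = g u := fun u hu => by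
    simp [hu.symm]
  have hgw : (g + Finsupp.single w c) w = g w + c := by simp
  have hzero : ∀ z, z ≠ w → ¬ C.Adj w z → g z = 0 := fun z hz hn =>
    by_contra fun h => hn (hw z h hz)
  -- The two conditions differ only at the non-edges `{w, z}`, where both say that `k z = 0`.
  have hkz : ∀ k, Orthogonal C g k → ∀ z, z ≠ w → ¬ C.Adj w z → k z = 0 := by
    intro k hk z hz hn
    have hgz := hzero z hz hn
    by_cases hgw0 : g w = 0
    · -- Otherwise `v`, `w`, `v'` and `z` form a square.
      by_contra hkz
      have hadj : ∀ u, g u ≠ 0 → C.Adj z u := by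
        intro u hu
        by_contra hn'
        have := hk z u hn'
        rw [hgz, zero_mul, eq_comm, mul_eq_zero] at this
        exact this.elim hu hkz
      have hne : ∀ u, g u ≠ 0 → u ≠ w := fun u hu h => hu (h ▸ hgw0)
      exact hC.no_square v w v' z hvv' (Ne.symm hz)
        ⟨(hw v hv (hne v hv)).symm, hw v' hv' (hne v' hv'), (hadj v' hv').symm, hadj v hv⟩
    · have := hk w z hn
      rw [hgz, zero_mul, mul_eq_zero] at this
      exact this.resolve_left hgw0
  have hkz' : ∀ k, Orthogonal C (g + Finsupp.single w c) k → ∀ z, z ≠ w → ¬ C.Adj w z →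
      k z = 0 := by
    intro k hk z hz hn
    have := hk w z hn
    rw [happ z hz, hzero z hz hn, zero_mul, mul_eq_zero, hgw] at this
    exact this.resolve_left hc
  refine ⟨g + Finsupp.single w c, fun k => ⟨fun hk x y hxy => ?_, fun hk x y hxy => ?_⟩, ?_⟩
  · by_cases hx : x = w <;> by_cases hy : y = w
    · subst hx; subst hy; rfl
    · subst hx
      rw [happ y hy, hzero y hy hxy, hkz k hk y hy hxy, zero_mul, mul_zero]
    · subst hy
      have hxy' : ¬ C.Adj y x := fun h => hxy h.symm
      rw [happ x hx, hzero x hx hxy', hkz k hk x hx hxy', zero_mul, mul_zero]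
    · rw [happ x hx, happ y hy]; exact hk x y hxy
  · by_cases hx : x = w <;> by_cases hy : y = w
    · subst hx; subst hy; rfl
    · subst hx
      rw [hzero y hy hxy, hkz' k hk y hy hxy, zero_mul, mul_zero]
    · subst hy
      have hxy' : ¬ C.Adj y x := fun h => hxy h.symm
      rw [hzero x hx hxy', hkz' k hk x hx hxy', zero_mul, mul_zero]
    · have := hk x y hxy
      rwa [happ x hx, happ y hy] at this
  · intro α hα
    obtain ⟨u, hu, huw⟩ : ∃ u, g u ≠ 0 ∧ u ≠ w := by
      by_cases h : v = w
      · exact ⟨v', hv', fun h' => hvv' (h.trans h'.symm)⟩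
      · exact ⟨v, hv, h⟩
    have h₁ := DFunLike.congr_fun hα u
    rw [happ u huw, Finsupp.smul_apply, smul_eq_mul] at h₁
    have hα1 : α = 1 := mul_right_cancel₀ hu (by rw [one_mul, ← h₁])
    have h₃ := DFunLike.congr_fun hα w
    rw [hgw, hα1, one_smul] at h₃
    exact hc0 (by simpa using h₃)

end Form

/-! ### Commutation in the Mekler group -/

/-- The Heisenberg group of a commutative ring, in symmetric form: the product adds the alternating
form `x y' - x' y` to the last coordinate. -/
@[ext]
structure Heisenberg (R : Type*) where
  /-- The first coordinate. -/
  x : R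
  /-- The second coordinate. -/
  y : R
  /-- The central coordinate. -/
  z : R

namespace Heisenberg

variable {R : Type*} [CommRing R]

instance : Mul (Heisenberg R) :=
  ⟨fun a b => ⟨a.x + b.x, a.y + b.y, a.z + b.z + (a.x * b.y - b.x * a.y)⟩⟩

instance : One (Heisenberg R) := ⟨⟨0, 0, 0⟩⟩

instance : Inv (Heisenberg R) := ⟨fun a => ⟨-a.x, -a.y, -a.z⟩⟩

@[simp] lemma mul_x (a b : Heisenberg R) : (a * b).x = a.x + b.x := rfl
@[simp] lemma mul_y (a b : Heisenberg R) : (a * b).y = a.y + b.y := rfl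
@[simp] lemma mul_z (a b : Heisenberg R) :
    (a * b).z = a.z + b.z + (a.x * b.y - b.x * a.y) := rfl
@[simp] lemma one_x : (1 : Heisenberg R).x = 0 := rfl
@[simp] lemma one_y : (1 : Heisenberg R).y = 0 := rfl
@[simp] lemma one_z : (1 : Heisenberg R).z = 0 := rfl
@[simp] lemma inv_x (a : Heisenberg R) : (a⁻¹).x = -a.x := rfl
@[simp] lemma inv_y (a : Heisenberg R) : (a⁻¹).y = -a.y := rfl
@[simp] lemma inv_z (a : Heisenberg R) : (a⁻¹).z = -a.z := rfl

instance : Group (Heisenberg R) :=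
  Group.ofLeftAxioms (fun a b c => by ext <;> simp <;> ring) (fun a => by ext <;> simp)
    (fun a => by ext <;> simp)

lemma pow_eq (a : Heisenberg R) (n : ℕ) : a ^ n = ⟨n * a.x, n * a.y, n * a.z⟩ := by
  induction n with
  | zero => ext <;> simp
  | succ n ih => rw [pow_succ, ih]; ext <;> simp <;> ring

lemma commute_iff (a b : Heisenberg R) :
    Commute a b ↔ 2 * (a.x * b.y) = 2 * (a.y * b.x) := by
  rw [commute_iff_eq, Heisenberg.ext_iff]
  simp only [mul_x, mul_y, mul_z]
  constructor
  · rintro ⟨-, -, h⟩; linear_combination h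
  · intro h; exact ⟨add_comm _ _, add_comm _ _, by linear_combination h⟩

end Heisenberg

lemma two_ne_zero_of_odd {p : ℕ} [hp : Fact p.Prime] (h : Odd p) : (2 : ZMod p) ≠ 0 := by
  refine Ring.two_ne_zero ?_
  rw [ZMod.ringChar_zmod_n]
  rintro rfl
  exact absurd h (by decide)

section MeklerGroup

variable {p : ℕ} {V : Type u} {C : SimpleGraph V}

/-- The universal property of the Mekler group. -/
def MeklerGroup.lift {H : Type*} [Group H] (f : V → H) (hpow : ∀ x : H, x ^ p = 1)
    (hnil : ∀ x y z : H, ⁅⁅x, y⁆, z⁆ = 1) (hadj : ∀ v w, C.Adj v w → Commute (f v) (f w)) :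
    MeklerGroup p C →* H :=
  PresentedGroup.toGroup (f := f) (by
    rintro r (⟨x, rfl⟩ | ⟨x, y, z, rfl⟩ | ⟨v, w, h, rfl⟩)
    · rw [map_pow, hpow]
    · simp only [map_commutatorElement, hnil]
    · rw [map_commutatorElement, FreeGroup.lift_apply_of, FreeGroup.lift_apply_of]
      exact commutatorElement_eq_one_iff_commute.2 (hadj v w h))

@[simp] lemma MeklerGroup.lift_vertex {H : Type*} [Group H] (f : V → H) (hpow hnil hadj) (v : V) :
    MeklerGroup.lift (p := p) (C := C) f hpow hnil hadj (vertex p C v) = f v :=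
  PresentedGroup.toGroup.of _

lemma MeklerGroup.hom_ext {H : Type*} [Group H] {f g : MeklerGroup p C →* H}
    (h : ∀ v, f (vertex p C v) = g (vertex p C v)) : f = g :=
  PresentedGroup.ext h

lemma MeklerGroup.pow_eq_one (g : MeklerGroup p C) : g ^ p = 1 := by
  obtain ⟨x, rfl⟩ := PresentedGroup.mk_surjective _ g
  rw [← map_pow]
  exact PresentedGroup.one_of_mem (Or.inl ⟨x, rfl⟩)

lemma MeklerGroup.commutator_commutator (g h k : MeklerGroup p C) : ⁅⁅g, h⁆, k⁆ = 1 := by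
  obtain ⟨x, rfl⟩ := PresentedGroup.mk_surjective _ g
  obtain ⟨y, rfl⟩ := PresentedGroup.mk_surjective _ h
  obtain ⟨z, rfl⟩ := PresentedGroup.mk_surjective _ k
  rw [← map_commutatorElement, ← map_commutatorElement]
  exact PresentedGroup.one_of_mem (Or.inr (Or.inl ⟨x, y, z, rfl⟩))

lemma MeklerGroup.commutator_mem_center (g h : MeklerGroup p C) :
    ⁅g, h⁆ ∈ Subgroup.center (MeklerGroup p C) :=
  Subgroup.mem_center_iff.2 fun k =>
    (commutatorElement_eq_one_iff_mul_comm.1 (commutator_commutator g h k)).symm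

lemma commute_vertex {v w : V} (h : C.Adj v w) : Commute (vertex p C v) (vertex p C w) := by
  rw [← commutatorElement_eq_one_iff_commute]
  exact PresentedGroup.one_of_mem (Or.inr (Or.inr ⟨v, w, h, rfl⟩))

variable (p C) in
/-- The homomorphism from the Mekler group to the `ZMod p`-vector space on the vertices. -/
noncomputable def exponentsHom : MeklerGroup p C →* Multiplicative (V →₀ ZMod p) :=
  MeklerGroup.lift (fun v => Multiplicative.ofAdd (Finsupp.single v 1))
    (fun x => by
      rw [← ofAdd_toAdd x, ← ofAdd_nsmul, ← Nat.cast_smul_eq_nsmul (ZMod p)]; simp)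
    (fun _ _ _ => commutatorElement_eq_one_iff_mul_comm.2 (mul_comm _ _))
    (fun _ _ _ => Commute.all _ _)

/-- The vector of exponents of an element of the Mekler group, in a representation as a product of
powers of vertices modulo the derived subgroup. -/
noncomputable def exponents (g : MeklerGroup p C) : V →₀ ZMod p :=
  (exponentsHom p C g).toAdd

lemma exponents_vertex (v : V) : exponents (vertex p C v) = Finsupp.single v 1 := by
  simp [exponents, exponentsHom]

lemma exponents_one : exponents (1 : MeklerGroup p C) = 0 := by simp [exponents]

lemma exponents_mul (g h : MeklerGroup p C) : exponents (g * h) = exponents g + exponents h := by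
  simp [exponents]

lemma exponents_inv (g : MeklerGroup p C) : exponents g⁻¹ = -exponents g := by
  simp [exponents]

lemma exponents_pow (g : MeklerGroup p C) (n : ℕ) :
    exponents (g ^ n) = (n : ZMod p) • exponents g := by
  simp [exponents, Nat.cast_smul_eq_nsmul]

lemma exponents_list_prod {n : ℕ} (x : Fin n → MeklerGroup p C) :
    exponents (List.ofFn x).prod = ∑ i, exponents (x i) := by
  rw [exponents, map_list_prod, List.map_ofFn, List.prod_ofFn, toAdd_prod]
  rfl

lemma exponents_surjective [NeZero p] (f : V →₀ ZMod p) :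
    ∃ g : MeklerGroup p C, exponents g = f := by
  induction f using Finsupp.induction_linear with
  | zero => exact ⟨1, exponents_one⟩
  | add f g hf hg =>
    obtain ⟨a, rfl⟩ := hf
    obtain ⟨b, rfl⟩ := hg
    exact ⟨a * b, exponents_mul a b⟩
  | single v c =>
    refine ⟨vertex p C v ^ c.val, ?_⟩
    rw [exponents_pow, exponents_vertex, ZMod.natCast_zmod_val, Finsupp.smul_single_one]

/-- Commuting elements have orthogonal exponents: the minor at a non-edge `{u, w}` is detected by
the homomorphism to the Heisenberg group sending `u` and `w` to the standard generators, and
all other vertices to `1`. -/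
lemma orthogonal_of_commute [Fact p.Prime] (hp : Odd p) {g h : MeklerGroup p C}
    (hgh : Commute g h) : Orthogonal C (exponents g) (exponents h) := by
  classical
  intro u w huw
  by_cases hne : u = w
  · subst hne; rfl
  have hwu : ¬ C.Adj w u := fun h => huw h.symm
  let f : V → Heisenberg (ZMod p) := fun v => ⟨if v = u then 1 else 0, if v = w then 1 else 0, 0⟩
  let Φ : MeklerGroup p C →* Heisenberg (ZMod p) := MeklerGroup.lift f
    (fun x => by rw [Heisenberg.pow_eq]; ext <;> simp)
    (fun x y z => by
      rw [commutatorElement_eq_one_iff_commute, Heisenberg.commute_iff]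
      simp [commutatorElement_def])
    (fun v v' hvv' => by
      rw [Heisenberg.commute_iff]
      have : ¬ (v = u ∧ v' = w) := fun h => huw (h.1 ▸ h.2 ▸ hvv')
      have : ¬ (v = w ∧ v' = u) := fun h => hwu (h.1 ▸ h.2 ▸ hvv')
      simp only [f]
      split_ifs <;> simp_all)
  have hΦx : ∀ g, (Φ g).x = exponents g u := by
    let α : Heisenberg (ZMod p) →* Multiplicative (ZMod p) :=
      ⟨⟨fun a => Multiplicative.ofAdd a.x, rfl⟩, fun _ _ => rfl⟩
    let β : Multiplicative (V →₀ ZMod p) →* Multiplicative (ZMod p) :=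
      AddMonoidHom.toMultiplicative (Finsupp.applyAddHom u)
    have : α.comp Φ = β.comp (exponentsHom p C) := MeklerGroup.hom_ext fun v => by
      simp [α, β, Φ, f, exponentsHom, Finsupp.single_apply]
    exact fun g => congrArg Multiplicative.toAdd (DFunLike.congr_fun this g)
  have hΦy : ∀ g, (Φ g).y = exponents g w := by
    let α : Heisenberg (ZMod p) →* Multiplicative (ZMod p) :=
      ⟨⟨fun a => Multiplicative.ofAdd a.y, rfl⟩, fun _ _ => rfl⟩
    let β : Multiplicative (V →₀ ZMod p) →* Multiplicative (ZMod p) :=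
      AddMonoidHom.toMultiplicative (Finsupp.applyAddHom w)
    have : α.comp Φ = β.comp (exponentsHom p C) := MeklerGroup.hom_ext fun v => by
      simp [α, β, Φ, f, exponentsHom, Finsupp.single_apply]
    exact fun g => congrArg Multiplicative.toAdd (DFunLike.congr_fun this g)
  have key := (Heisenberg.commute_iff _ _).1 (hgh.map Φ)
  rw [hΦx, hΦx, hΦy, hΦy] at key
  have h2 : (2 : ZMod p) ≠ 0 := two_ne_zero_of_odd hp
  exact mul_left_cancel₀ h2 key

end MeklerGroup

section Bilinear

variable {p : ℕ} {V : Type u} {C : SimpleGraph V}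

variable (p C) in
/-- The centre of the Mekler group, written additively. -/
def AddCenter : Type u := Additive (Subgroup.center (MeklerGroup p C))

open scoped IsMulCommutative in
instance : AddCommGroup (AddCenter p C) :=
  inferInstanceAs (AddCommGroup (Additive (Subgroup.center (MeklerGroup p C))))

/-- The bilinear map on finitely supported vectors with given values at the basis vectors. -/
noncomputable def bilinearOfBasis {R Z : Type*} [CommRing R] [AddCommGroup Z] [Module R Z]
    (κ : V → V → Z) : (V →₀ R) →ₗ[R] (V →₀ R) →ₗ[R] Z :=
  Finsupp.linearCombination R fun v => Finsupp.linearCombination R fun w => κ v w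

lemma bilinearOfBasis_apply {R Z : Type*} [CommRing R] [AddCommGroup Z] [Module R Z]
    (κ : V → V → Z) {S : Finset V} {f g : V →₀ R} (hf : f.support ⊆ S) (hg : g.support ⊆ S) :
    bilinearOfBasis κ f g = ∑ v ∈ S, ∑ w ∈ S, (f v * g w) • κ v w := by
  rw [bilinearOfBasis, Finsupp.linearCombination_apply,
    Finsupp.sum_of_support_subset f hf _ (by simp), LinearMap.sum_apply]
  refine Finset.sum_congr rfl fun v _ => ?_
  rw [LinearMap.smul_apply, Finsupp.linearCombination_apply,
    Finsupp.sum_of_support_subset g hg _ (by simp), Finset.smul_sum]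
  exact Finset.sum_congr rfl fun w _ => smul_smul _ _ _

/-- The commutator as a map to the centre, written additively. -/
def centralCommutator (g h : MeklerGroup p C) : AddCenter p C :=
  Additive.ofMul ⟨⁅g, h⁆, MeklerGroup.commutator_mem_center g h⟩

lemma centralCommutator_eq_zero_iff {g h : MeklerGroup p C} :
    centralCommutator g h = 0 ↔ Commute g h :=
  Subtype.ext_iff.trans commutatorElement_eq_one_iff_commute

lemma centralCommutator_mul_right (g h k : MeklerGroup p C) :
    centralCommutator g (h * k) = centralCommutator g h + centralCommutator g k := by
  refine congrArg Additive.ofMul (Subtype.ext ?_)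
  change ⁅g, h * k⁆ = ⁅g, h⁆ * ⁅g, k⁆
  have := Subgroup.mem_center_iff.1 (MeklerGroup.commutator_mem_center g k) h
  calc ⁅g, h * k⁆ = ⁅g, h⁆ * (h * ⁅g, k⁆) * h⁻¹ := by simp only [commutatorElement_def]; group
    _ = ⁅g, h⁆ * ⁅g, k⁆ := by rw [this]; group

lemma centralCommutator_swap (g h : MeklerGroup p C) :
    centralCommutator h g = -centralCommutator g h :=
  congrArg Additive.ofMul (Subtype.ext (commutatorElement_inv g h).symm)

lemma centralCommutator_mul_left (g h k : MeklerGroup p C) :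
    centralCommutator (g * h) k = centralCommutator g k + centralCommutator h k := by
  rw [centralCommutator_swap k, centralCommutator_mul_right, centralCommutator_swap g,
    centralCommutator_swap h, neg_add, neg_neg, neg_neg]

/-- Elements with orthogonal exponents commute: by bilinearity, the square of the commutator of
`g` and `h` is the product of the commutators `[u, w]`, raised to the minors of
the exponents of `g` and `h` at `{u, w}`. -/
lemma commute_of_orthogonal [Fact p.Prime] (hp : Odd p) {g h : MeklerGroup p C}
    (H : Orthogonal C (exponents g) (exponents h)) : Commute g h := by
  classical
  -- Only the existence of this structure matters, so it is kept opaque.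
  have : Module (ZMod p) (AddCenter p C) :=
    AddCommGroup.zmodModule fun x =>
      have hz : ∀ z : Subgroup.center (MeklerGroup p C), z ^ p = 1 := fun z =>
        Subtype.ext (MeklerGroup.pow_eq_one (z : MeklerGroup p C))
      hz x
  let κ : V → V → AddCenter p C := fun v w => centralCommutator (vertex p C v) (vertex p C w)
  let β := bilinearOfBasis (R := ZMod p) κ
  have hβv : ∀ v k, centralCommutator (vertex p C v) k = β (Finsupp.single v 1) (exponents k) := by
    intro v k
    let Φ : MeklerGroup p C →* Multiplicative (AddCenter p C) :=
      MonoidHom.mk' (fun k => Multiplicative.ofAdd (centralCommutator (vertex p C v) k))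
        fun a b => congrArg Multiplicative.ofAdd (centralCommutator_mul_right _ a b)
    let Ψ : MeklerGroup p C →* Multiplicative (AddCenter p C) :=
      MonoidHom.mk' (fun k => Multiplicative.ofAdd (β (Finsupp.single v 1) (exponents k)))
        fun a b => by rw [exponents_mul, map_add, ofAdd_add]
    have : Φ = Ψ := MeklerGroup.hom_ext fun w => by
      simp [Φ, Ψ, β, κ, bilinearOfBasis, exponents_vertex]
    exact congrArg Multiplicative.toAdd (DFunLike.congr_fun this k)
  have hβ : ∀ g k, centralCommutator g k = β (exponents g) (exponents k) := by
    intro g k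
    let Φ : MeklerGroup p C →* Multiplicative (AddCenter p C) :=
      MonoidHom.mk' (fun g => Multiplicative.ofAdd (centralCommutator g k))
        fun a b => congrArg Multiplicative.ofAdd (centralCommutator_mul_left a b k)
    let Ψ : MeklerGroup p C →* Multiplicative (AddCenter p C) :=
      MonoidHom.mk' (fun g => Multiplicative.ofAdd (β (exponents g) (exponents k)))
        fun a b => by rw [exponents_mul, map_add, LinearMap.add_apply, ofAdd_add]
    have : Φ = Ψ := MeklerGroup.hom_ext fun w => by
      simp only [Φ, Ψ, MonoidHom.mk'_apply, hβv, exponents_vertex]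
    exact congrArg Multiplicative.toAdd (DFunLike.congr_fun this g)
  let S := (exponents g).support ∪ (exponents h).support
  have h2 : (2 : ZMod p) • centralCommutator g h = 0 := by
    rw [two_smul]
    nth_rw 2 [← neg_neg (centralCommutator g h)]
    rw [← centralCommutator_swap g h, ← sub_eq_add_neg, hβ, hβ,
      bilinearOfBasis_apply (S := S) κ Finset.subset_union_left Finset.subset_union_right,
      bilinearOfBasis_apply (S := S) κ Finset.subset_union_right Finset.subset_union_left,
      ← Finset.sum_sub_distrib]
    refine Finset.sum_eq_zero fun v _ => ?_
    rw [← Finset.sum_sub_distrib]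
    refine Finset.sum_eq_zero fun w _ => ?_
    rw [← sub_smul]
    by_cases hvw : C.Adj v w
    · rw [show κ v w = 0 from centralCommutator_eq_zero_iff.2 (commute_vertex hvw), smul_zero]
    · rw [H v w hvw, mul_comm (exponents h v), sub_self, zero_smul]
  rw [← centralCommutator_eq_zero_iff]
  exact (smul_eq_zero.1 h2).resolve_left (two_ne_zero_of_odd hp)

lemma commute_iff_orthogonal [Fact p.Prime] (hp : Odd p) {g h : MeklerGroup p C} :
    Commute g h ↔ Orthogonal C (exponents g) (exponents h) :=
  ⟨orthogonal_of_commute hp, commute_of_orthogonal hp⟩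

end Bilinear

/-! ### Elements of type `1^ν` and uniqueness of supports -/

section Types

lemma simSetoid_iff {G : Type u} [Group G] {g h : G} :
    simSetoid G g h ↔ ∀ k, Commute g k ↔ Commute h k := by
  change Subgroup.centralizer {g} = Subgroup.centralizer {h} ↔ _
  simp only [SetLike.ext_iff, Subgroup.mem_centralizer_singleton_iff]
  exact forall_congr' fun k => by rw [commute_iff_eq, commute_iff_eq, eq_comm, eq_comm (a := k * h)]

variable {p : ℕ} [hp : Fact p.Prime] {V : Type u} {C : SimpleGraph V}

lemma mem_center_iff_exponents_eq_zero (hodd : Odd p) (hC : IsNice C) {g : MeklerGroup p C} :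
    g ∈ Subgroup.center (MeklerGroup p C) ↔ exponents g = 0 := by
  rw [Subgroup.mem_center_iff, ← hC.forall_orthogonal_iff]
  constructor
  · intro H f
    obtain ⟨k, rfl⟩ := exponents_surjective (C := C) f
    exact orthogonal_of_commute hodd (H k).symm
  · exact fun H k => (commute_of_orthogonal hodd (H _)).symm

lemma simSetoid_iff_orthogonal (hodd : Odd p) {g h : MeklerGroup p C} :
    simSetoid _ g h ↔ ∀ k, Orthogonal C (exponents g) k ↔ Orthogonal C (exponents h) k := by
  rw [simSetoid_iff]
  constructor
  · intro H f
    obtain ⟨k, rfl⟩ := exponents_surjective (C := C) f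
    rw [← commute_iff_orthogonal hodd, ← commute_iff_orthogonal hodd, H]
  · intro H k
    rw [commute_iff_orthogonal hodd, commute_iff_orthogonal hodd, H]

lemma approx_iff (hodd : Odd p) (hC : IsNice C) {g h : MeklerGroup p C} :
    Approx p g h ↔ ∃ α : ZMod p, α ≠ 0 ∧ exponents h = α • exponents g := by
  constructor
  · rintro ⟨α, h0, hlt, c, hc, rfl⟩
    refine ⟨α, ?_, ?_⟩
    · rw [Ne, ZMod.natCast_eq_zero_iff]
      exact Nat.not_dvd_of_pos_of_lt h0 hlt
    · rw [exponents_mul, exponents_pow, (mem_center_iff_exponents_eq_zero hodd hC).1 hc, add_zero]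
  · rintro ⟨α, h0, h⟩
    refine ⟨α.val, (ZMod.val_pos).2 h0, ZMod.val_lt α, (g ^ α.val)⁻¹ * _, ?_,
      (mul_inv_cancel_left _ _).symm⟩
    rw [mem_center_iff_exponents_eq_zero hodd hC, exponents_mul, exponents_inv, exponents_pow,
      ZMod.natCast_zmod_val, h, neg_add_cancel]

lemma isOfType_one_iff (hodd : Odd p) (hC : IsNice C) {g : MeklerGroup p C} :
    IsOfType p 1 g ↔ ∀ h, simSetoid _ g h → Approx p g h := by
  rw [IsOfType, Nat.cast_one, Set.encard_eq_one]
  constructor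
  · rintro ⟨s, hs⟩ h hgh
    have h₁ : {k | Approx p g k} = s := by
      rw [← Set.mem_singleton_iff, ← hs]
      exact ⟨g, (simSetoid _).refl g, rfl⟩
    have h₂ : {k | Approx p h k} = s := by
      rw [← Set.mem_singleton_iff, ← hs]
      exact ⟨h, hgh, rfl⟩
    have : h ∈ {k | Approx p h k} := (approx_iff hodd hC).2 ⟨1, one_ne_zero, (one_smul _ _).symm⟩
    rw [h₂, ← h₁] at this
    exact this
  · intro H
    refine ⟨{k | Approx p g k}, Set.eq_singleton_iff_unique_mem.2
      ⟨⟨g, (simSetoid _).refl g, rfl⟩, ?_⟩⟩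
    rintro _ ⟨h, hgh, rfl⟩
    obtain ⟨α, h0, hα⟩ := (approx_iff hodd hC).1 (H h hgh)
    ext k
    simp only [Set.mem_ofPred_eq, approx_iff hodd hC, hα]
    constructor
    · rintro ⟨β, hβ, h⟩
      exact ⟨β * α, mul_ne_zero hβ h0, by rw [h, smul_smul]⟩
    · rintro ⟨β, hβ, h⟩
      exact ⟨β / α, div_ne_zero hβ h0, by rw [h, smul_smul, div_mul_cancel₀ _ h0]⟩

/-- The elements of type `1^ν` are, modulo the centre, the powers of vertices. -/
lemma mem_typeOneNu_iff (hodd : Odd p) (hC : IsNice C) {g : MeklerGroup p C} :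
    g ∈ typeOneNu p (MeklerGroup p C) ↔
      ∃ (v : V) (a : ZMod p), a ≠ 0 ∧ exponents g = Finsupp.single v a := by
  rw [typeOneNu, Set.mem_ofPred_eq, mem_center_iff_exponents_eq_zero hodd hC,
    isOfType_one_iff hodd hC]
  constructor
  · rintro ⟨h0, h₁, hiso⟩
    simp only [IsIsolated, not_forall] at hiso
    obtain ⟨h, hh, hgh, happ⟩ := hiso
    rw [mem_center_iff_exponents_eq_zero hodd hC] at hh
    rw [approx_iff hodd hC] at happ
    push Not at happ
    obtain ⟨w, hw⟩ := hC.exists_hub (orthogonal_of_commute hodd hgh) hh happ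
    obtain ⟨v, hv⟩ := Finsupp.ne_iff.1 h0
    refine ⟨v, exponents g v, hv, ?_⟩
    by_contra hne
    obtain ⟨v', hv'⟩ := Finsupp.ne_iff.1 hne
    have hvv' : v ≠ v' := by rintro rfl; simp at hv'
    rw [Finsupp.single_eq_of_ne' hvv'] at hv'
    obtain ⟨f, hf, hfne⟩ := hC.exists_orthogonal_iff (two_ne_zero_of_odd hodd) hw hv hv' hvv'
    obtain ⟨k, rfl⟩ := exponents_surjective (C := C) f
    obtain ⟨α, -, hα⟩ := (approx_iff hodd hC).1 (h₁ k ((simSetoid_iff_orthogonal hodd).2 hf))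
    exact hfne α hα
  · rintro ⟨v, a, ha, hg⟩
    refine ⟨by rw [hg]; simpa using ha, fun h hgh => ?_, fun hiso => ?_⟩
    · rw [simSetoid_iff_orthogonal hodd, hg] at hgh
      have hh := hC.eq_single_of_orthogonal_iff ha hgh
      have hv0 : exponents h v ≠ 0 := by
        intro h0
        rw [h0, Finsupp.single_zero] at hh
        have := (hC.forall_orthogonal_iff _).1 fun k =>
          (hgh k).2 ((hC.forall_orthogonal_iff _).2 hh k)
        exact ha (by simpa using this)
      rw [approx_iff hodd hC]
      refine ⟨exponents h v / a, div_ne_zero hv0 ha, ?_⟩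
      rw [hg, Finsupp.smul_single, smul_eq_mul, div_mul_cancel₀ _ ha]
      exact hh
    · obtain ⟨w, hvw⟩ := hC.exists_adj v
      have := hiso (vertex p C w)
        (by rw [mem_center_iff_exponents_eq_zero hodd hC, exponents_vertex]; simp)
        (by
          rw [commute_iff_orthogonal hodd, exponents_vertex, hg]
          exact orthogonal_single_single hvw _ _)
      obtain ⟨α, -, hα⟩ := (approx_iff hodd hC).1 this
      have := DFunLike.congr_fun hα w
      rw [exponents_vertex, hg] at this
      simp [Finsupp.single_eq_of_ne' hvw.ne] at this

/-- Two powers of vertices modulo the centre, both non-central, are `∼`-equivalent if and only if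
the vertices are the same. -/
lemma simSetoid_iff_of_single (hodd : Odd p) (hC : IsNice C) {g h : MeklerGroup p C} {v w : V}
    {a b : ZMod p} (ha : a ≠ 0) (hb : b ≠ 0) (hg : exponents g = Finsupp.single v a)
    (hh : exponents h = Finsupp.single w b) : simSetoid _ g h ↔ v = w := by
  rw [simSetoid_iff_orthogonal hodd, hg, hh]
  constructor
  · intro H
    have := hC.eq_single_of_orthogonal_iff ha H
    by_contra hne
    rw [Finsupp.single_eq_of_ne hne, Finsupp.single_zero, Finsupp.single_eq_zero] at this
    exact hb this
  · rintro rfl k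
    have key : ∀ c d : ZMod p, d ≠ 0 → Orthogonal C (Finsupp.single v d) k →
        Orthogonal C (Finsupp.single v c) k := fun c d hd H => by
      have := H.smul (c / d)
      rwa [Finsupp.smul_single, smul_eq_mul, div_mul_cancel₀ _ hd] at this
    exact ⟨key b a ha, key a b hb⟩

/-- The exponents of an element of the Mekler group which is a product, modulo the centre, of
inequivalent elements of type `1^ν`, in terms of the vertices belonging to these elements. -/
lemma IsDecomposition.exists_vertices (hodd : Odd p) (hC : IsNice C) {n : ℕ} {g : MeklerGroup p C}
    {x : Fin n → MeklerGroup p C} (h : IsDecomposition p n (QuotientGroup.mk g) x) :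
    ∃ (v : Fin n → V) (a : Fin n → ZMod p), Function.Injective v ∧ (∀ i, a i ≠ 0) ∧
      (∀ i, exponents (x i) = Finsupp.single (v i) (a i)) ∧
      exponents g = ∑ i, Finsupp.single (v i) (a i) := by
  obtain ⟨h₁, h₂, h₃⟩ := h
  choose v a ha hva using fun i => (mem_typeOneNu_iff hodd hC).1 (h₁ i)
  refine ⟨v, a, fun i j hij => h₂ i j ?_, ha, hva, ?_⟩
  · exact (simSetoid_iff_of_single hodd hC (ha i) (ha j) (hva i) (hva j)).2 hij
  · have := (mem_center_iff_exponents_eq_zero hodd hC).1 (QuotientGroup.eq.1 h₃)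
    rw [exponents_mul, exponents_inv, neg_add_eq_zero, exponents_list_prod] at this
    simpa only [hva] using this

end Types

/-! ### Expressibility in the language of groups -/

section Expressible

variable {G : Type u} [Group G] {α β : Type}

/-- A function of tuples of elements of a group is a term function if it is given by a term. -/
def IsTermFun (f : (α → G) → G) : Prop :=
  ∃ t : groupLang.Term α, ∀ v, t.realize v = f v

/-- A property of tuples of elements of a group is expressible if it is given by a first-order
formula without parameters. -/
def IsExpressible (P : (α → G) → Prop) : Prop :=
  ∃ φ : groupLang.Formula α, ∀ v, φ.Realize v ↔ P v

namespace IsTermFun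

lemma var (a : α) : IsTermFun fun v : α → G => v a := ⟨Language.var a, fun _ => rfl⟩

lemma one : IsTermFun fun _ : α → G => 1 :=
  ⟨Language.Term.func (L := groupLang) GroupFunc.one Fin.elim0, fun _ => rfl⟩

lemma mul {f g : (α → G) → G} (hf : IsTermFun f) (hg : IsTermFun g) :
    IsTermFun fun v => f v * g v := by
  obtain ⟨s, hs⟩ := hf
  obtain ⟨t, ht⟩ := hg
  exact ⟨Language.Term.func (L := groupLang) GroupFunc.mul ![s, t],
    fun v => congrArg₂ (· * ·) (hs v) (ht v)⟩

lemma inv {f : (α → G) → G} (hf : IsTermFun f) : IsTermFun fun v => (f v)⁻¹ := by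
  obtain ⟨s, hs⟩ := hf
  exact ⟨Language.Term.func (L := groupLang) GroupFunc.inv ![s],
    fun v => congrArg (·⁻¹) (hs v)⟩

lemma pow {f : (α → G) → G} (hf : IsTermFun f) (n : ℕ) : IsTermFun fun v => f v ^ n := by
  induction n with
  | zero => simpa using one
  | succ n ih => simpa only [pow_succ] using ih.mul hf

lemma list_prod {n : ℕ} {f : Fin n → (α → G) → G} (hf : ∀ i, IsTermFun (f i)) :
    IsTermFun fun v => (List.ofFn fun i => f i v).prod := by
  induction n with
  | zero => simpa using one
  | succ n ih =>
    simp only [List.ofFn_succ, List.prod_cons]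
    exact (hf 0).mul (ih fun i => hf i.succ)

/-- A term function remains one if variables are added. -/
lemma weaken {f : (α → G) → G} (hf : IsTermFun f) :
    IsTermFun fun w : α ⊕ β → G => f (w ∘ Sum.inl) := by
  obtain ⟨s, hs⟩ := hf
  exact ⟨s.relabel Sum.inl, fun w => by rw [Language.Term.realize_relabel, hs]⟩

end IsTermFun

namespace IsExpressible

lemma congr {P Q : (α → G) → Prop} (hP : IsExpressible P) (h : ∀ v, P v ↔ Q v) :
    IsExpressible Q := by
  obtain ⟨φ, hφ⟩ := hP
  exact ⟨φ, fun v => (hφ v).trans (h v)⟩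

lemma eq {f g : (α → G) → G} (hf : IsTermFun f) (hg : IsTermFun g) :
    IsExpressible fun v => f v = g v := by
  obtain ⟨s, hs⟩ := hf
  obtain ⟨t, ht⟩ := hg
  exact ⟨s.equal t, fun v => by rw [Language.Formula.realize_equal, hs, ht]⟩

lemma const (q : Prop) : IsExpressible fun _ : α → G => q := by
  by_cases hq : q
  · exact ⟨⊤, fun v => by simp [hq]⟩
  · exact ⟨⊥, fun v => by simp [hq]⟩

lemma not {P : (α → G) → Prop} (hP : IsExpressible P) : IsExpressible fun v => ¬ P v := by
  obtain ⟨φ, hφ⟩ := hP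
  exact ⟨φ.not, fun v => by rw [Language.Formula.realize_not, hφ]⟩

lemma and {P Q : (α → G) → Prop} (hP : IsExpressible P) (hQ : IsExpressible Q) :
    IsExpressible fun v => P v ∧ Q v := by
  obtain ⟨φ, hφ⟩ := hP
  obtain ⟨ψ, hψ⟩ := hQ
  exact ⟨φ ⊓ ψ, fun v => by rw [Language.Formula.realize_inf, hφ, hψ]⟩

lemma imp {P Q : (α → G) → Prop} (hP : IsExpressible P) (hQ : IsExpressible Q) :
    IsExpressible fun v => P v → Q v := by
  obtain ⟨φ, hφ⟩ := hP
  obtain ⟨ψ, hψ⟩ := hQ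
  exact ⟨φ.imp ψ, fun v => by rw [Language.Formula.realize_imp, hφ, hψ]⟩

lemma iff {P Q : (α → G) → Prop} (hP : IsExpressible P) (hQ : IsExpressible Q) :
    IsExpressible fun v => (P v ↔ Q v) :=
  ((hP.imp hQ).and (hQ.imp hP)).congr fun _ => iff_def.symm

lemma forall_finite {ι : Type} [Finite ι] {P : ι → (α → G) → Prop}
    (hP : ∀ i, IsExpressible (P i)) : IsExpressible fun v => ∀ i, P i v := by
  choose φ hφ using hP
  exact ⟨Language.Formula.iInf φ, fun v => by simp only [Language.Formula.realize_iInf, hφ]⟩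

lemma exists_finite {ι : Type} [Finite ι] {P : ι → (α → G) → Prop}
    (hP : ∀ i, IsExpressible (P i)) : IsExpressible fun v => ∃ i, P i v := by
  choose φ hφ using hP
  exact ⟨Language.Formula.iSup φ, fun v => by simp only [Language.Formula.realize_iSup, hφ]⟩

lemma exists_tuple [Finite β] {P : (α → G) → (β → G) → Prop}
    (hP : IsExpressible fun w : α ⊕ β → G => P (w ∘ Sum.inl) (w ∘ Sum.inr)) :
    IsExpressible fun v => ∃ x, P v x := by
  obtain ⟨φ, hφ⟩ := hP
  exact ⟨φ.iExs β, fun v => by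
    simp only [Language.Formula.realize_iExs, hφ, Sum.elim_comp_inl, Sum.elim_comp_inr]⟩

lemma exists_elem {P : (α → G) → G → Prop}
    (hP : IsExpressible fun w : α ⊕ Unit → G => P (w ∘ Sum.inl) (w (Sum.inr ()))) :
    IsExpressible fun v => ∃ x, P v x :=
  (exists_tuple (P := fun v x => P v (x ())) hP).congr fun _ =>
    ⟨fun ⟨x, hx⟩ => ⟨x (), hx⟩, fun ⟨x, hx⟩ => ⟨fun _ => x, hx⟩⟩

lemma forall_elem {P : (α → G) → G → Prop}
    (hP : IsExpressible fun w : α ⊕ Unit → G => P (w ∘ Sum.inl) (w (Sum.inr ()))) :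
    IsExpressible fun v => ∀ x, P v x :=
  (exists_elem (P := fun v x => ¬ P v x) hP.not).not.congr fun _ => by push Not; rfl

variable {f g : (α → G) → G}

lemma commute (hf : IsTermFun f) (hg : IsTermFun g) :
    IsExpressible fun v => Commute (f v) (g v) :=
  eq (hf.mul hg) (hg.mul hf)

lemma mem_center (hf : IsTermFun f) : IsExpressible fun v => f v ∈ Subgroup.center G :=
  (forall_elem (commute (IsTermFun.var _) hf.weaken)).congr fun _ => Subgroup.mem_center_iff.symm

lemma sim (hf : IsTermFun f) (hg : IsTermFun g) :
    IsExpressible fun v => simSetoid G (f v) (g v) :=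
  (forall_elem ((commute hf.weaken (IsTermFun.var _)).iff
    (commute hg.weaken (IsTermFun.var _)))).congr fun _ => simSetoid_iff.symm

lemma approx (p : ℕ) (hf : IsTermFun f) (hg : IsTermFun g) :
    IsExpressible fun v => Approx p (f v) (g v) := by
  refine (exists_finite fun n : Fin p => (const (0 < (n : ℕ))).and <| exists_elem
    (P := fun v c => c ∈ Subgroup.center G ∧ g v = f v ^ (n : ℕ) * c) <|
      (mem_center (IsTermFun.var _)).and <|
        eq hg.weaken ((hf.weaken.pow n).mul (IsTermFun.var _))).congr fun v => ?_
  exact ⟨fun ⟨n, h0, c, hc, h⟩ => ⟨n, h0, n.2, c, hc, h⟩,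
    fun ⟨n, h0, hn, c, hc, h⟩ => ⟨⟨n, hn⟩, h0, c, hc, h⟩⟩

lemma isIsolated (p : ℕ) (hf : IsTermFun f) : IsExpressible fun v => IsIsolated p (f v) :=
  forall_elem <| (mem_center (IsTermFun.var _)).not.imp <|
    (commute hf.weaken (IsTermFun.var _)).imp (approx p hf.weaken (IsTermFun.var _))

end IsExpressible

variable {p : ℕ} [Fact p.Prime] {V : Type u} {C : SimpleGraph V}

namespace IsExpressible

variable {f : (α → MeklerGroup p C) → MeklerGroup p C}

lemma mem_typeOneNu (hodd : Odd p) (hC : IsNice C) (hf : IsTermFun f) :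
    IsExpressible fun v => f v ∈ typeOneNu p (MeklerGroup p C) :=
  ((mem_center hf).not.and <| (forall_elem <| (sim hf.weaken (IsTermFun.var _)).imp
    (approx p hf.weaken (IsTermFun.var _))).and (isIsolated p hf).not).congr fun _ => by
      rw [← isOfType_one_iff hodd hC]; rfl

lemma isDecomposition (hodd : Odd p) (hC : IsNice C) (hf : IsTermFun f) {n : ℕ}
    {x : Fin n → (α → MeklerGroup p C) → MeklerGroup p C} (hx : ∀ i, IsTermFun (x i)) :
    IsExpressible fun v => IsDecomposition p n (QuotientGroup.mk (f v)) fun i => x i v := by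
  refine ((forall_finite fun i => mem_typeOneNu hodd hC (hx i)).and <|
    (forall_finite fun i => forall_finite fun j => (sim (hx i) (hx j)).imp (const (i = j))).and <|
      mem_center (hf.inv.mul (IsTermFun.list_prod hx))).congr fun v => ?_
  rw [IsDecomposition, QuotientGroup.eq]

end IsExpressible

/-! ### The inp-patterns of the Mekler group -/

variable (p C) in
/-- The formula `ψ_m(x, y)` expressing that `x`, modulo the centre, is a product of `m` inequivalent
elements of type `1^ν`, and that `y` is `∼`-equivalent to one of them. -/
lemma exists_formula_support (hodd : Odd p) (hC : IsNice C) (m : ℕ) :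
    ∃ ψ : groupLang.Formula (Unit ⊕ Fin 1), ∀ g h : MeklerGroup p C,
      ψ.Realize (Sum.elim (fun _ => g) (fun _ => h)) ↔
        (QuotientGroup.mk g ∈ supportPredicate p m (MeklerGroup p C) ∧
          Quotient.mk (simSetoid (MeklerGroup p C)) h ∈
            support p m (QuotientGroup.mk g : MeklerGroup p C ⧸ Subgroup.center _)) := by
  obtain ⟨ψ, hψ⟩ : IsExpressible fun v : Unit ⊕ Fin 1 → MeklerGroup p C =>
      ∃ x : Fin m → MeklerGroup p C, IsDecomposition p m (QuotientGroup.mk (v (Sum.inl ()))) x ∧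
        ∃ i, simSetoid (MeklerGroup p C) (v (Sum.inr 0)) (x i) :=
    IsExpressible.exists_tuple <|
      (IsExpressible.isDecomposition hodd hC (IsTermFun.var _) fun i => IsTermFun.var _).and <|
        IsExpressible.exists_finite fun i =>
          IsExpressible.sim (IsTermFun.var _) (IsTermFun.var (Sum.inr i))
  refine ⟨ψ, fun g h => (hψ _).trans ⟨?_, ?_⟩⟩
  · rintro ⟨x, hx, i, hi⟩
    exact ⟨⟨x, hx⟩, x, hx, i, Quotient.sound hi⟩
  · rintro ⟨-, x, hx, i, hi⟩
    exact ⟨x, hx, i, Quotient.exact hi⟩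

lemma vertex_mem_typeOneNu (hodd : Odd p) (hC : IsNice C) (v : V) :
    vertex p C v ∈ typeOneNu p (MeklerGroup p C) :=
  (mem_typeOneNu_iff hodd hC).2 ⟨v, 1, one_ne_zero, exponents_vertex v⟩

lemma isDecomposition_vertex (hodd : Odd p) (hC : IsNice C) {m : ℕ} {v : Fin m → V}
    (hv : Function.Injective v) :
    IsDecomposition p m (QuotientGroup.mk (List.ofFn fun i => vertex p C (v i)).prod)
      fun i => vertex p C (v i) :=
  ⟨fun i => vertex_mem_typeOneNu hodd hC (v i), fun _ _ h => hv <|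
    (simSetoid_iff_of_single hodd hC one_ne_zero one_ne_zero (exponents_vertex _)
      (exponents_vertex _)).1 h, rfl⟩

/-- Supports are unique: if the class of a vertex belongs to the support of `g`, then this
vertex occurs in the exponents of `g`. -/
lemma exponents_ne_zero_of_mem_support (hodd : Odd p) (hC : IsNice C) {m : ℕ}
    {g : MeklerGroup p C} {v : V}
    (h : Quotient.mk (simSetoid (MeklerGroup p C)) (vertex p C v) ∈
      support p m (QuotientGroup.mk g : MeklerGroup p C ⧸ Subgroup.center _)) :
    exponents g v ≠ 0 := by
  classical
  obtain ⟨x, hx, i, hi⟩ := h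
  obtain ⟨w, a, hw, ha, hxw, hg⟩ := hx.exists_vertices hodd hC
  have hvw : v = w i := (simSetoid_iff_of_single hodd hC one_ne_zero (ha i) (exponents_vertex v)
    (hxw i)).1 (Quotient.exact hi)
  rw [hg, Finsupp.finsetSum_apply, Finset.sum_eq_single i, hvw, Finsupp.single_eq_same]
  · exact ha i
  · intro j _ hji
    rw [hvw, Finsupp.single_eq_of_ne' (hw.ne hji)]
  · simp

lemma card_support_exponents_le (hodd : Odd p) (hC : IsNice C) {m : ℕ} {g : MeklerGroup p C}
    (h : QuotientGroup.mk g ∈ supportPredicate p m (MeklerGroup p C)) :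
    (exponents g).support.card ≤ m := by
  classical
  obtain ⟨x, hx⟩ := h
  obtain ⟨w, a, -, -, -, hg⟩ := hx.exists_vertices hodd hC
  have : (exponents g).support ⊆ Finset.univ.image w := by
    intro v hv
    rw [Finsupp.mem_support_iff, hg, Finsupp.finsetSum_apply] at hv
    obtain ⟨i, -, hi⟩ := Finset.exists_ne_zero_of_sum_ne_zero hv
    rw [Finset.mem_image]
    refine ⟨i, Finset.mem_univ _, by_contra fun hne => hi ?_⟩
    exact Finsupp.single_eq_of_ne' hne
  exact (Finset.card_le_card this).trans (Finset.card_image_le.trans (by simp))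

/-- The rows are `(m + 1)`-inconsistent because at most `m` vertices belong to the support of an
element of `A_{m,0}`. A path is realised by the product of its vertices. -/
lemma isInpPattern_support (hodd : Odd p) (hC : IsNice C) {m : ℕ}
    {ψ : groupLang.Formula (Unit ⊕ Fin 1)}
    (hψ : ∀ g h : MeklerGroup p C, ψ.Realize (Sum.elim (fun _ => g) (fun _ => h)) ↔
        (QuotientGroup.mk g ∈ supportPredicate p m (MeklerGroup p C) ∧
          Quotient.mk (simSetoid (MeklerGroup p C)) h ∈
            support p m (QuotientGroup.mk g : MeklerGroup p C ⧸ Subgroup.center _)))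
    {a : Fin m → ℕ → V} (ha : ∀ i j i' j', a i j = a i' j' → i = i' ∧ j = j') :
    IsInpPattern groupLang (MeklerGroup p C) (fun _ : Fin m => 1) (fun _ => ψ)
      (fun i j _ => vertex p C (a i j)) (fun _ => m + 1) where
  row_inconsistent i s hs := by
    classical
    rintro ⟨g, hg⟩
    have hg' := fun j hj => (hψ g _).1 (hg j hj)
    obtain ⟨j₀, hj₀⟩ : s.Nonempty := Finset.card_pos.1 (by omega)
    have hle := card_support_exponents_le hodd hC (hg' j₀ hj₀).1
    have hsub : s.image (a i) ⊆ (exponents g).support := by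
      intro v hv
      obtain ⟨j, hj, rfl⟩ := Finset.mem_image.1 hv
      exact Finsupp.mem_support_iff.2 (exponents_ne_zero_of_mem_support hodd hC (hg' j hj).2)
    have := Finset.card_le_card hsub
    rw [Finset.card_image_of_injective _ fun j j' h => (ha i j i j' h).2] at this
    omega
  path_consistent η t := by
    have hdec := isDecomposition_vertex (p := p) hodd hC (v := fun i => a i (η i))
      fun i i' h => (ha _ _ _ _ h).1
    exact ⟨_, fun i _ => (hψ _ _).2 ⟨⟨_, hdec⟩, _, hdec, i, rfl⟩⟩

lemma alephZeroMinus_le_groupBurden (hodd : Odd p) (hC : IsNice C) [Infinite V] :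
    ExtCardinal.alephZeroMinus ≤ groupBurden (MeklerGroup p C) := by
  intro κ hκ
  obtain ⟨m, rfl⟩ := Cardinal.lt_aleph0.1 (Set.mem_Iio.1 hκ)
  obtain ⟨ψ, hψ⟩ := exists_formula_support p C hodd hC m
  let e := Infinite.natEmbedding V
  have hinp := isInpPattern_support hodd hC hψ (a := fun i j => e (Nat.pair i j))
    fun i j i' j' h => by
      have := Nat.pair_eq_pair.1 (e.injective h)
      exact ⟨Fin.ext this.1, this.2⟩
  refine mem_burden_iff.2 ⟨m, ⟨MeklerGroup p C, inferInstance, rfl, ULift (Fin m), fun _ => 1,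
    fun _ => ψ, fun i j _ => vertex p C (e (Nat.pair i.down j)), fun _ => m + 1, by simp,
    fun i => hinp.row_inconsistent i.down, fun η t => ?_⟩, le_rfl⟩
  obtain ⟨g, hg⟩ := hinp.path_consistent (fun i => η ⟨i⟩) Finset.univ
  exact ⟨g, fun i _ => hg i.down (Finset.mem_univ _)⟩

end Expressible

end Mekler

theorem mainTheorem5 (p : ℕ) (hp : p.Prime) (hp_odd : Odd p) :
    (∀ (V : Type u) (C : SimpleGraph V), Infinite V → Mekler.IsNice C →
      -- the burden of `M(C)` is at least `ℵ₀₋`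
      Mekler.ExtCardinal.alephZeroMinus ≤ Mekler.groupBurden (Mekler.MeklerGroup p C) ∧
      -- for every `m`, the formula `A_{m,0}(π(x)) ∧ [y] ∈ S_{m,0}(π(x))` and any array of distinct
      -- vertices form an inp-pattern of depth `m`, with `(m + 1)`-inconsistent rows
      (∀ m : ℕ, ∃ ψ : Mekler.groupLang.Formula (Unit ⊕ Fin 1),
        (∀ g h : Mekler.MeklerGroup p C,
          ψ.Realize (Sum.elim (fun _ => g) (fun _ => h)) ↔
            (QuotientGroup.mk g ∈ Mekler.supportPredicate p m (Mekler.MeklerGroup p C) ∧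
              Quotient.mk (Mekler.simSetoid (Mekler.MeklerGroup p C)) h ∈
                Mekler.support p m
                  (QuotientGroup.mk g :
                    Mekler.MeklerGroup p C ⧸ Subgroup.center (Mekler.MeklerGroup p C)))) ∧
        ∀ a : Fin m → ℕ → V, (∀ i j i' j', a i j = a i' j' → i = i' ∧ j = j') →
          Mekler.IsInpPattern Mekler.groupLang (Mekler.MeklerGroup p C)
            (fun _ : Fin m => 1) (fun _ => ψ)
            (fun i j _ => Mekler.vertex p C (a i j)) (fun _ => m + 1))) ∧
    -- burden is not preserved by Mekler's construction, not even its finiteness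
    (∃ (V : Type) (C : SimpleGraph V), Infinite V ∧ Mekler.IsNice C ∧
      Mekler.graphBurden C = Mekler.ExtCardinal.ofCardinal 1 ∧
      Mekler.graphBurden C < Mekler.groupBurden (Mekler.MeklerGroup p C)) := by

  have : Fact p.Prime := ⟨hp⟩
  refine ⟨fun V C _ hC => ⟨Mekler.alephZeroMinus_le_groupBurden hp_odd hC, fun m => ?_⟩,
    ℤ, Mekler.integerPath, inferInstance, Mekler.isNice_integerPath,
    Mekler.graphBurden_integerPath, ?_⟩
  · obtain ⟨ψ, hψ⟩ := Mekler.exists_formula_support p C hp_odd hC m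
    exact ⟨ψ, hψ, fun a ha => Mekler.isInpPattern_support hp_odd hC hψ ha⟩
  · have hle := Mekler.alephZeroMinus_le_groupBurden hp_odd Mekler.isNice_integerPath
    rw [Mekler.graphBurden_integerPath]
    refine lt_of_lt_of_le (lt_of_le_of_ne ?_ ?_) hle
    · intro κ hκ
      exact lt_of_le_of_lt (Set.mem_Iic.1 hκ) Cardinal.one_lt_aleph0
    · intro h
      have h2 : (2 : Cardinal) ∈ Mekler.ExtCardinal.alephZeroMinus :=
        Set.mem_Iio.2 Cardinal.natCast_lt_aleph0
      rw [← h] at h2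
      exact absurd (Set.mem_Iic.1 h2) (not_le.2 Cardinal.one_lt_two)
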